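/- **Setup.** Fix an episode length $T\ge 1$, a vector $\mu_0\in\mathbb R^T$, an invertible matrix $\Sigma_0\in\mathbb R^{T\times T}$, a level $\alpha\in(0,1)$ and $\varepsilon\ge 0$; write $\mathbf 1$ for an all-ones vector. A signal $X_1,\dots,X_n$ is a *$T$-long episodic signal with parameters $(\mu,\Sigma_0)$* if its consecutive blocks of length $T$ (episodes) are i.i.d. random vectors in $\mathbb R^T$ with mean $\mu$ and covariance matrix $\Sigma_0$ (the last block may be cropped); within an episode the entries may be dependent and non-identically distributed, and no normality is assumed. Let $X_1,X_2,\dots$ be real random variables. Under $H_0$, for every $n$, $X_1,\dots,X_n$ is such a signal with parameters $(\mu_0,\Sigma_0)$. Under $H_A^{\varepsilon,K}$ ($K\ge 1$), $X_1,\dots,X_{KT}$ is such a signal with parameters $(\mu_0-\frac{\varepsilon}{\sqrt K}\mathbf 1,\Sigma_0)$. The episode law under $H_A^{\varepsilon,K}$ may vary with $K$ provided that, for all $1\le t\le T$ and $\delta>0$, the centred entries $Z_t=X_t-(\mu_0)_t+\varepsilon/\sqrt K$ satisfy $E\big[Z_t^2\,\mathbf 1\{|Z_t|>\delta\sqrt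 K\}\,\big|\,H_A^{\varepsilon,K}\big]\to0$ as $K\to\infty$. (This is automatic if the law of the centred episode does not depend on $K$, for example if the alternative is the $H_0$-signal shifted by $-\varepsilon/\sqrt K$.) For $x\in\mathbb R^n$ put $s_{simp}(x)=\sum_{t=1}^n x_t$ and $s_{unif}(x)=\mathbf 1^\top\Sigma^{-1}x$, where $\Sigma\in\mathbb R^{n\times n}$ is the block-diagonal covariance matrix of the whole signal, with blocks $\Sigma_0$ (the last one cropped if $T\nmid n$). For $s\in\{s_{simp},s_{unif}\}$ let $$\tilde s^K=\frac{s(X_1,\dots,X_{KT})-K\,E[s(X_1,\dots,X_T)\mid H_0]}{\sqrt{K\,\mathrm{Var}(s(X_1,\dots,X_T)\mid H_0)}}.$$ Let $\Phi$ be the standard normal distribution function and $q_\alpha$ its $\alpha$-quantile. **Theorem.** $$\lim_{K\to\infty}P\big(\tilde s^K_{simp}\le q_\alpha\mid H_A^{\varepsilon,K}\big)=\Phi\Big(q_\alpha+\frac{\varepsilon T}{\sqrt{\mathbf 1^\top\Sigma_0\mathbf 1}}\Big)\le\Phi\Big(q_\alpha+\varepsilon\sqrt{\mathbf 1^\top\Sigma_0^{-1}\mathbf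 1}\Big)=\lim_{K\to\infty}P\big(\tilde s^K_{unif}\le q_\alpha\mid H_A^{\varepsilon,K}\big).$$ Moreover, the same two limits hold, respectively, for the probability of rejection under $H_A^{\varepsilon,K}$ of any threshold tests on $s_{simp}(X_1,\dots,X_{KT})$ and on $s_{unif}(X_1,\dots,X_{KT})$ that are tuned to have significance $\alpha$ under $H_0$; here a threshold test with threshold $\kappa_K\in\mathbb R$ and edge probability $\rho_K\in[0,1]$ rejects if $s<\kappa_K$, rejects with probability $\rho_K$ if $s=\kappa_K$, and does not reject if $s>\kappa_K$. -/

import Mathlib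

open MeasureTheory ProbabilityTheory Filter Topology Matrix

noncomputable section

/-- The first `n` observations `(X_1, …, X_n)` of a signal (time is 0-indexed: `X 0, …, X (n-1)`). -/
def obs {Ω : Type*} (X : ℕ → Ω → ℝ) (n : ℕ) (ω : Ω) : Fin n → ℝ := fun i => X i ω

/-- The joint law of `n` consecutive observations of a signal made of i.i.d. episodes of length `T`
with episode law `ν`: observation `i` is entry `i % T` of episode number `i / T`, the episodes are
independent with law `ν`, and the last episode is cropped if `T` does not divide `n`. -/
def episodicLaw (T : ℕ) [NeZero T] (ν : Measure (Fin T → ℝ)) (n : ℕ) : Measure (Fin n → ℝ) :=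
  (Measure.infinitePi (fun _ : ℕ => ν)).map
    (fun (e : ℕ → Fin T → ℝ) (i : Fin n) => e (i.val / T) (Fin.ofNat T i.val))

/-- `ν` is a probability law of one episode `(X_1, …, X_T)`, square integrable, with mean vector
`μ₀` and covariance matrix `Sig₀`. -/
structure IsEpisodeLaw {T : ℕ} (ν : Measure (Fin T → ℝ)) (μ₀ : Fin T → ℝ)
    (Sig₀ : Matrix (Fin T) (Fin T) ℝ) : Prop where
  isProbabilityMeasure : IsProbabilityMeasure ν
  memLp : ∀ t, MemLp (fun x : Fin T → ℝ => x t) 2 ν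
  mean : ∀ t, ∫ x, x t ∂ν = μ₀ t
  cov : ∀ s t, cov[fun x : Fin T → ℝ => x s, fun x : Fin T → ℝ => x t; ν] = Sig₀ s t

/-- Under the probability measure `P`, the first `n` observations of `X` form a `T`-long episodic
signal with parameters `μ₀, Sig₀`. -/
def IsEpisodicSignal {Ω : Type*} [MeasurableSpace Ω] (P : Measure Ω) (X : ℕ → Ω → ℝ) (n T : ℕ)
    [NeZero T] (μ₀ : Fin T → ℝ) (Sig₀ : Matrix (Fin T) (Fin T) ℝ) : Prop :=
  ∃ ν : Measure (Fin T → ℝ), IsEpisodeLaw ν μ₀ Sig₀ ∧ HasLaw (obs X n) (episodicLaw T ν n) P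

/-- The covariance matrix `Σ` of the whole signal of length `n`: block diagonal with blocks `Sig₀`
(the last block is cropped if `T` does not divide `n`). -/
def signalCov {T : ℕ} [NeZero T] (Sig₀ : Matrix (Fin T) (Fin T) ℝ) (n : ℕ) :
    Matrix (Fin n) (Fin n) ℝ :=
  Matrix.of fun i j =>
    if i.val / T = j.val / T then Sig₀ (Fin.ofNat T i.val) (Fin.ofNat T j.val) else 0

/-- The simple statistic `s_simp(x) = ∑ x_t`. -/
def sSimp (n : ℕ) (x : Fin n → ℝ) : ℝ := ∑ i, x i

/-- The uniform-degradation weighted mean `s_unif(x) = W ⬝ x` with `W = 1ᵀ Σ⁻¹`. -/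
def sUnif {T : ℕ} [NeZero T] (Sig₀ : Matrix (Fin T) (Fin T) ℝ) (n : ℕ) (x : Fin n → ℝ) : ℝ :=
  ((1 : Fin n → ℝ) ᵥ* (signalCov Sig₀ n)⁻¹) ⬝ᵥ x

/-- The normalized statistic after `K` episodes of length `T`:
`(S(X_1..X_{KT}) - K E[S(X_1..X_T) | H₀]) / √(K Var(S(X_1..X_T) | H₀))`,
where `P₀` is the distribution under `H₀`. -/
def normalizedStat {Ω : Type*} [MeasurableSpace Ω] (P₀ : Measure Ω) (X : ℕ → Ω → ℝ) (T : ℕ)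
    (S : (n : ℕ) → (Fin n → ℝ) → ℝ) (K : ℕ) (ω : Ω) : ℝ :=
  (S (K * T) (obs X (K * T) ω) - K * ∫ ω', S T (obs X T ω') ∂P₀) /
    √(K * Var[fun ω' => S T (obs X T ω'); P₀])

/-- The probability, under `P`, that the threshold test with statistic `s`, threshold `κ` and
edge-case probability `ρ` rejects: it rejects if `s < κ`, and with probability `ρ` if `s = κ`. -/
def rejectProb {Ω : Type*} [MeasurableSpace Ω] (P : Measure Ω) (s : Ω → ℝ) (κ ρ : ℝ) : ℝ :=
  P.real {ω | s ω < κ} + ρ * P.real {ω | s ω = κ}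

/-- The cumulative distribution function `Φ` of the standard normal distribution. -/
def stdNormalCDF (x : ℝ) : ℝ := cdf (gaussianReal 0 1) x

/-- The `α`-quantile of the standard normal distribution. -/
def stdNormalQuantile (α : ℝ) : ℝ := sInf {x : ℝ | α ≤ stdNormalCDF x}

/-- Lindeberg's condition for the episodes of a sequence of hypotheses: under the `K`-th measure
`P K` the episodes have mean vector `m K`, and the centred episode entries satisfy
`E[|X_t - m_t|² ; |X_t - m_t| > δ √K] → 0` for every `δ > 0` and every time-step `t`. By dominated
convergence it holds whenever the law of the centred episode is square integrable and the same for
all `K`, in particular if the `K`-th law is a translate of one fixed law. -/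
def EpisodesLindeberg {Ω : Type*} [MeasurableSpace Ω] (P : ℕ → Measure Ω) (X : ℕ → Ω → ℝ) (T : ℕ)
    (m : ℕ → Fin T → ℝ) : Prop :=
  ∀ t : Fin T, ∀ δ : ℝ, 0 < δ →
    Tendsto (fun K : ℕ => ∫ ω in {ω | δ * √(K : ℝ) < |X t ω - m K t|}, (X t ω - m K t) ^ 2 ∂(P K))
      atTop (𝓝 0)

end

/-! On a signal of `K` whole episodes both statistics are sums `∑ k, w ⬝ᵥ e k` over independent
episodes, with `w = 1` for `sSimp` and `w = 1 ᵥ* Sig₀⁻¹` for `sUnif`, because a block-diagonal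
matrix is inverted block by block. The episode law may change with `K`, so asymptotic normality
comes from Lindeberg's theorem for triangular arrays (`tendsto_cdf_sum_of_lindeberg`), proved with
characteristic functions.

Under the alternative the sum of `K` episodes has mean lower by `√K * ε * (w ⬝ᵥ 1)` and standard
deviation `√(K * v)`, where `v = w ⬝ᵥ (Sig₀ *ᵥ w)`. The normalized statistic is therefore displaced
by the constant `ε * (w ⬝ᵥ 1) / √v`, and the power tends to `Φ` at `q_α` plus this constant. A test
of significance `α` has a normalized threshold converging to `q_α`, hence the same limit
(`tendsto_power_linear_statistic`).

Comparing the two limits amounts to `T² ≤ (1ᵀ Sig₀ 1) (1ᵀ Sig₀⁻¹ 1)`, which is Cauchy-Schwarz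
(`sq_dotProduct_le_of_posDef`). -/

/-! ### Lindeberg's central limit theorem by characteristic functions. -/

/-- The second order Taylor remainder of `exp (i y)` is of order `min (|y| ^ 3, y ^ 2)`. -/
lemma norm_cexp_mul_I_sub_taylor_le (y : ℝ) :
    ‖Complex.exp (y * Complex.I) - (1 + y * Complex.I - y ^ 2 / 2)‖ ≤ 4 * y ^ 2 * min 1 |y| := by
  have hy2 : (y : ℂ) ^ 2 / 2 = ((y ^ 2 / 2 : ℝ) : ℂ) := by push_cast; ring
  rcases le_total |y| 1 with h | h
  · rw [min_eq_right h]
    have hn : ‖(y : ℂ) * Complex.I‖ = |y| := by simp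
    have := Complex.exp_bound (x := (y : ℂ) * Complex.I) (by rw [hn]; exact h) (n := 3) (by norm_num)
    rw [hn] at this
    have e : ∑ m ∈ Finset.range 3, ((y : ℂ) * Complex.I) ^ m / (m.factorial : ℂ)
        = 1 + y * Complex.I - y ^ 2 / 2 := by
      simp [Finset.sum_range_succ, Nat.factorial, mul_pow, Complex.I_sq]
      ring
    rw [e] at this
    refine this.trans ?_
    have e3 : 4 * y ^ 2 * |y| = 4 * |y| ^ 3 := by rw [← sq_abs y]; ring
    rw [e3]
    norm_num [Nat.factorial]
    linarith [pow_nonneg (abs_nonneg y) 3]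
  -- For `|y| ≥ 1` the triangle inequality gives `2 + |y| + y² / 2 ≤ 7 / 2 * y²`; this case dictates
  -- the constant 4.
  · rw [min_eq_left h, hy2]
    calc _ ≤ ‖Complex.exp (y * Complex.I)‖ + (‖(1 : ℂ)‖ + ‖(y : ℂ) * Complex.I‖
          + ‖((y ^ 2 / 2 : ℝ) : ℂ)‖) :=
        (norm_sub_le _ _).trans (by gcongr; exact (norm_sub_le _ _).trans (by gcongr; exact norm_add_le _ _))
      _ = 1 + (1 + |y| + y ^ 2 / 2) := by
        rw [Complex.norm_exp_ofReal_mul_I, Complex.norm_real]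
        simp
      _ ≤ _ := by
        rw [← sq_abs y]; nlinarith

/-- Pointwise form of Lindeberg's estimate for the Taylor remainder. -/
lemma norm_cexp_mul_I_sub_taylor_le_indicator (s y : ℝ) {r : ℝ} (hr : 0 ≤ r) :
    ‖Complex.exp ((s * y : ℝ) * Complex.I) - (1 + (s * y : ℝ) * Complex.I - (s * y : ℝ) ^ 2 / 2)‖ ≤
      4 * s ^ 2 * (|s| * r * y ^ 2 + {x : ℝ | r < |x|}.indicator (fun x => x ^ 2) y) := by
  have h0 := norm_cexp_mul_I_sub_taylor_le (s * y)
  refine h0.trans ?_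
  by_cases hy : r < |y|
  · rw [Set.indicator_of_mem (by exact hy)]
    have := min_le_left 1 |s * y|
    have := min_le_right 1 |s * y|
    have : 0 ≤ |s| * r * y ^ 2 := by positivity
    nlinarith [sq_nonneg (s * y), sq_nonneg s, mul_nonneg (sq_nonneg s) this]
  · rw [Set.indicator_of_notMem (by exact hy), add_zero]
    have h2 : |s * y| ≤ |s| * r := by rw [abs_mul]; gcongr; exact not_lt.1 hy
    have := (min_le_right 1 |s * y|).trans h2
    calc _ ≤ 4 * (s * y) ^ 2 * (|s| * r) := by gcongr
      _ = _ := by ring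

/-- Lindeberg's estimate: the error in the second order expansion of the characteristic function
of a centred law with second moment `v`. -/
lemma norm_charFun_sub_taylor_le (ν : Measure ℝ) [IsProbabilityMeasure ν] (h2 : MemLp id 2 ν)
    (h0 : ∫ y, y ∂ν = 0) {v : ℝ} (hv : ∫ y, y ^ 2 ∂ν = v) (s : ℝ) {r : ℝ} (hr : 0 ≤ r) :
    ‖charFun ν s - (1 - s ^ 2 * v / 2)‖ ≤
      4 * s ^ 2 * (|s| * r * v + ∫ y in {x : ℝ | r < |x|}, y ^ 2 ∂ν) := by
  have i1 : Integrable (fun y : ℝ => y) ν := h2.integrable (by norm_num)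
  have i2 : Integrable (fun y : ℝ => y ^ 2) ν := h2.integrable_sq
  have hm : MeasurableSet {x : ℝ | r < |x|} := measurableSet_lt (by fun_prop) (by fun_prop)
  have ie : Integrable (fun y : ℝ => Complex.exp ((s * y : ℝ) * Complex.I)) ν := by
    refine Integrable.of_bound (by fun_prop) 1 (ae_of_all _ fun y => ?_)
    rw [Complex.norm_exp_ofReal_mul_I]
  have j1 : Integrable (fun y : ℝ => ((s * y : ℝ) : ℂ) * Complex.I) ν :=
    ((i1.const_mul s).ofReal (𝕜 := ℂ)).mul_const _
  have j2 : Integrable (fun y : ℝ => ((s * y : ℝ) : ℂ) ^ 2 / 2) ν := by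
    have : Integrable (fun y : ℝ => ((s ^ 2 / 2 * y ^ 2 : ℝ) : ℂ)) ν := (i2.const_mul _).ofReal
    refine this.congr (ae_of_all _ fun y => ?_)
    push_cast; ring
  have e1 : ∫ y : ℝ, ((s * y : ℝ) : ℂ) * Complex.I ∂ν = 0 := by
    rw [integral_mul_const, integral_complex_ofReal, integral_const_mul, h0]; simp
  have e2 : ∫ y : ℝ, ((s * y : ℝ) : ℂ) ^ 2 / 2 ∂ν = (s : ℂ) ^ 2 * (v : ℂ) / 2 := by
    have : ∀ y : ℝ, ((s * y : ℝ) : ℂ) ^ 2 / 2 = ((s ^ 2 / 2 * y ^ 2 : ℝ) : ℂ) := by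
      intro y; push_cast; ring
    simp_rw [this]
    rw [integral_complex_ofReal, integral_const_mul, hv]; push_cast; ring
  have key : charFun ν s - (1 - s ^ 2 * v / 2) = ∫ y : ℝ, (Complex.exp ((s * y : ℝ) * Complex.I) -
      (1 + (s * y : ℝ) * Complex.I - (s * y : ℝ) ^ 2 / 2)) ∂ν := by
    have j3 : Integrable (fun y : ℝ => 1 + ((s * y : ℝ) : ℂ) * Complex.I) ν :=
      (integrable_const _).add j1
    have j4 : Integrable (fun y : ℝ => 1 + ((s * y : ℝ) : ℂ) * Complex.I - ((s * y : ℝ) : ℂ) ^ 2 / 2) ν :=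
      j3.sub j2
    rw [integral_sub ie j4, integral_sub j3 j2, integral_add (integrable_const _) j1, e1, e2,
      charFun_apply_real]
    simp
  rw [key]
  calc _ ≤ ∫ y : ℝ, 4 * s ^ 2 * (|s| * r * y ^ 2 +
        {x : ℝ | r < |x|}.indicator (fun x => x ^ 2) y) ∂ν :=
      norm_integral_le_of_norm_le (((i2.const_mul _).add (i2.indicator hm)).const_mul _)
        (ae_of_all _ fun y => norm_cexp_mul_I_sub_taylor_le_indicator s y hr)
    _ = _ := by
      rw [integral_const_mul, integral_add (i2.const_mul _) (i2.indicator hm), integral_const_mul, hv,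
        integral_indicator hm]

/-- Convergence of characteristic functions in Lindeberg's central limit theorem for rows of
identically distributed variables. -/
lemma tendsto_charFun_pow_of_lindeberg (ν : ℕ → Measure ℝ) [∀ K, IsProbabilityMeasure (ν K)] {v : ℝ}
    (h2 : ∀ K, 0 < K → MemLp id 2 (ν K)) (h0 : ∀ K, 0 < K → ∫ y, y ∂(ν K) = 0)
    (hv : ∀ K, 0 < K → ∫ y, y ^ 2 ∂(ν K) = v)
    (hL : ∀ δ : ℝ, 0 < δ →
      Tendsto (fun K : ℕ => ∫ y in {y : ℝ | δ * √(K : ℝ) < |y|}, y ^ 2 ∂(ν K)) atTop (𝓝 0)) (t : ℝ) :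
    Tendsto (fun K : ℕ => charFun (ν K) ((√(K : ℝ))⁻¹ * t) ^ K) atTop
      (𝓝 (Complex.exp (-(t ^ 2 * v / 2)))) := by
  have hv0 : 0 ≤ v := hv 1 one_pos ▸ integral_nonneg fun y => sq_nonneg y
  apply Complex.tendsto_pow_exp_of_isLittleO_sub_add_div
  rw [Asymptotics.isLittleO_iff]
  intro c hc
  -- With `s = t / √K` and `r = δ √K` the factor `|s| * r` is `|t| * δ`, free of `K`, so `δ` can be
  -- fixed before `K`. The `+ 1` keeps `A` positive at `t = 0`.
  set A := 4 * t ^ 2 + 1 with hA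
  have hA0 : 0 < A := by positivity
  obtain ⟨δ, hδ0, hδ⟩ : ∃ δ : ℝ, 0 < δ ∧ |t| * δ * v < c / (2 * A) := by
    refine ⟨c / (2 * A) / (|t| * v + 1), by positivity, ?_⟩
    have : |t| * (c / (2 * A) / (|t| * v + 1)) * v = c / (2 * A) * (|t| * v / (|t| * v + 1)) := by ring
    rw [this]
    refine mul_lt_of_lt_one_right (by positivity) ?_
    rw [div_lt_one (by positivity)]; linarith
  filter_upwards [eventually_gt_atTop 0, (hL δ hδ0).eventually (gt_mem_nhds (show 0 < c / (2 * A) by positivity))]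
    with K hK hLK
  have hK' : (0 : ℝ) < K := by exact_mod_cast hK
  have hs : √(K : ℝ) ^ 2 = K := Real.sq_sqrt hK'.le
  have hs0 : 0 < √(K : ℝ) := Real.sqrt_pos.2 hK'
  have key := norm_charFun_sub_taylor_le (ν K) (h2 K hK) (h0 K hK) (hv K hK) ((√(K : ℝ))⁻¹ * t)
    (r := δ * √(K : ℝ)) (by positivity)
  have e1 : ((((√(K : ℝ))⁻¹ * t : ℝ) : ℂ)) ^ 2 * v / 2 = (t ^ 2 * v / 2) / K := by
    norm_cast
    rw [mul_pow, inv_pow, hs]; ring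
  have e2 : (1 : ℂ) + -(t ^ 2 * v / 2) / K = 1 - (((√(K : ℝ))⁻¹ * t : ℝ) : ℂ) ^ 2 * v / 2 := by
    rw [e1]; ring
  rw [e2]
  refine key.trans ?_
  have e3 : |(√(K : ℝ))⁻¹ * t| * (δ * √(K : ℝ)) * v = |t| * δ * v := by
    rw [abs_mul, abs_of_pos (inv_pos.2 hs0)]; field_simp
  rw [e3, mul_pow, inv_pow, hs]
  have e4 : ‖1 / (K : ℂ)‖ = (K : ℝ)⁻¹ := by simp
  rw [e4]
  have hI : 0 ≤ ∫ y in {x : ℝ | δ * √(K : ℝ) < |x|}, y ^ 2 ∂(ν K) :=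
    integral_nonneg fun y => sq_nonneg y
  calc _ = (4 * t ^ 2) * (|t| * δ * v + ∫ y in {x : ℝ | δ * √(K : ℝ) < |x|}, y ^ 2 ∂(ν K)) * (K : ℝ)⁻¹ := by ring
    _ ≤ A * (c / (2 * A) + c / (2 * A)) * (K : ℝ)⁻¹ := by gcongr; linarith
    _ = _ := by field_simp; ring

/-- **Lindeberg's central limit theorem** for rows of i.i.d. variables: weak convergence. -/
lemma tendsto_map_sum_of_lindeberg (ν : ℕ → Measure ℝ) [∀ K, IsProbabilityMeasure (ν K)] {v : ℝ}
    (hvpos : 0 < v)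
    (h2 : ∀ K, 0 < K → MemLp id 2 (ν K)) (h0 : ∀ K, 0 < K → ∫ y, y ∂(ν K) = 0)
    (hv : ∀ K, 0 < K → ∫ y, y ^ 2 ∂(ν K) = v)
    (hL : ∀ δ : ℝ, 0 < δ →
      Tendsto (fun K : ℕ => ∫ y in {y : ℝ | δ * √(K : ℝ) < |y|}, y ^ 2 ∂(ν K)) atTop (𝓝 0))
    (ρ : ℕ → ProbabilityMeasure ℝ)
    (hρ : ∀ K, (ρ K : Measure ℝ) = (Measure.infinitePi fun _ : ℕ => ν K).map
      fun e => (√(K : ℝ))⁻¹ * ∑ k ∈ Finset.range K, e k / √v) :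
    Tendsto ρ atTop (𝓝 ⟨gaussianReal 0 1, inferInstance⟩) := by
  refine ProbabilityMeasure.tendsto_iff_tendsto_charFun.2 fun t => ?_
  have hc : ∀ K, charFun (ρ K : Measure ℝ) t = charFun (ν K) ((√(K : ℝ))⁻¹ * (t / √v)) ^ K := by
    intro K
    have hid : ∀ i : ℕ, (Measure.infinitePi fun _ : ℕ => ν K).map (fun e => e i / √v)
        = (ν K).map (fun x => x / √v) := fun i => by
      conv_rhs => rw [← Measure.infinitePi_map_eval (fun _ : ℕ => ν K) i]
      rw [Measure.map_map (by fun_prop) (by fun_prop)]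
      rfl
    rw [hρ, charFun_inv_sqrt_mul_sum (P := Measure.infinitePi fun _ : ℕ => ν K) (X := fun (k : ℕ) (e : ℕ → ℝ) => e k / √v)
      (iIndepFun_infinitePi (P := fun _ : ℕ => ν K) (X := fun _ (x : ℝ) => x / √v)
      (fun i => by fun_prop))
      (fun i => ⟨Measurable.aemeasurable (by fun_prop), Measurable.aemeasurable (by fun_prop), by rw [hid, hid]⟩), hid]
    simp_rw [div_eq_inv_mul]
    rw [charFun_map_mul]
    congr 2
    ring
  simp_rw [hc]
  convert tendsto_charFun_pow_of_lindeberg ν h2 h0 hv hL (t / √v) using 2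
  have : (((t / √v : ℝ) : ℂ)) ^ 2 * v = t ^ 2 := by
    norm_cast
    rw [div_pow, Real.sq_sqrt hvpos.le]; field_simp
  rw [this]
  simp [charFun_gaussianReal]

/-! ### The normal distribution function and convergence of distribution functions. -/

lemma continuous_stdNormalCDF : Continuous stdNormalCDF := by
  rw [continuous_iff_continuousAt]
  intro x
  have : NullSingletonClass (gaussianReal 0 1) := nullSingletonClass_gaussianReal one_ne_zero
  have h := (cdf (gaussianReal 0 1)).measure_singleton x
  -- The jump of a distribution function at `x` is the mass of `{x}`, which is zero here.
  rw [measure_cdf, measure_singleton, eq_comm, ENNReal.ofReal_eq_zero, sub_nonpos] at h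
  have := (cdf (gaussianReal 0 1)).mono.continuousAt_iff_leftLim_eq_rightLim.2
    (by rw [StieltjesFunction.rightLim_eq]; exact le_antisymm ((cdf (gaussianReal 0 1)).mono.leftLim_le le_rfl) h)
  exact this

lemma strictMono_stdNormalCDF : StrictMono stdNormalCDF := by
  intro a b hab
  have h : 0 < gaussianReal 0 1 (Set.Ioc a b) := by
    rw [pos_iff_ne_zero]
    -- Lebesgue measure is absolutely continuous with respect to the Gaussian, so a Gaussian-null
    -- interval would have length zero.
    intro h0
    have := gaussianReal_absolutelyContinuous' 0 one_ne_zero h0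
    rw [Real.volume_Ioc, ENNReal.ofReal_eq_zero] at this
    linarith
  rw [← measure_cdf (gaussianReal 0 1), StieltjesFunction.measure_Ioc, ENNReal.ofReal_pos] at h
  exact sub_pos.1 h

lemma stdNormalCDF_quantile {α : ℝ} (hα : α ∈ Set.Ioo (0 : ℝ) 1) :
    stdNormalCDF (stdNormalQuantile α) = α := by
  obtain ⟨x, hx⟩ : ∃ x, stdNormalCDF x = α := by
    refine mem_range_of_exists_le_of_exists_ge continuous_stdNormalCDF ?_ ?_
    · obtain ⟨x, hx⟩ := ((tendsto_cdf_atBot (gaussianReal 0 1)).eventually (gt_mem_nhds hα.1)).exists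
      exact ⟨x, hx.le⟩
    · obtain ⟨x, hx⟩ := ((tendsto_cdf_atTop (gaussianReal 0 1)).eventually (lt_mem_nhds hα.2)).exists
      exact ⟨x, hx.le⟩
  have : {y | α ≤ stdNormalCDF y} = Set.Ici x := by
    ext y; simp only [Set.mem_ofPred_eq, Set.mem_Ici, ← hx]
    exact strictMono_stdNormalCDF.le_iff_le
  rw [stdNormalQuantile, this, csInf_Ici, hx]

/-- Monotone functions squeezed around a sequence converging pointwise to a continuous limit. -/
lemma tendsto_of_tendsto_pointwise_of_monotone {F : ℕ → ℝ → ℝ} {G : ℝ → ℝ} (hG : Continuous G)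
    (hF : ∀ K, Monotone (F K)) (h : ∀ x, Tendsto (fun K => F K x) atTop (𝓝 (G x)))
    {p b : ℕ → ℝ} {b₀ : ℝ} (hb : Tendsto b atTop (𝓝 b₀)) (hp1 : ∀ᶠ K in atTop, p K ≤ F K (b K))
    (hp2 : ∀ᶠ K in atTop, ∀ x < b K, F K x ≤ p K) : Tendsto p atTop (𝓝 (G b₀)) := by
  rw [tendsto_order]
  constructor
  · intro a ha
    -- Comparing at a fixed `x` strictly on one side of `b₀` makes pointwise convergence enough; no
    -- uniformity is needed.
    obtain ⟨x, hxa, hx⟩ : ∃ x, a < G x ∧ x < b₀ :=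
      (((hG.continuousAt.eventually (lt_mem_nhds ha)).filter_mono (nhdsWithin_le_nhds (s := Set.Iio b₀))).and
        self_mem_nhdsWithin).exists
    filter_upwards [(h x).eventually (lt_mem_nhds hxa), hb.eventually (lt_mem_nhds hx), hp2]
      with K h1 h2 h3
    exact h1.trans_le (h3 x h2)
  · intro a ha
    obtain ⟨x, hxa, hx⟩ : ∃ x, G x < a ∧ b₀ < x :=
      (((hG.continuousAt.eventually (gt_mem_nhds ha)).filter_mono (nhdsWithin_le_nhds (s := Set.Ioi b₀))).and
        self_mem_nhdsWithin).exists
    filter_upwards [(h x).eventually (gt_mem_nhds hxa), hb.eventually (gt_mem_nhds hx), hp1]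
      with K h1 h2 h3
    exact (h3.trans (hF K h2.le)).trans_lt h1

/-- **Lindeberg's central limit theorem** for rows of i.i.d. variables: distribution functions. -/
lemma tendsto_cdf_sum_of_lindeberg (ν : ℕ → Measure ℝ) [∀ K, IsProbabilityMeasure (ν K)] {v : ℝ}
    (hvpos : 0 < v)
    (h2 : ∀ K, 0 < K → MemLp id 2 (ν K)) (h0 : ∀ K, 0 < K → ∫ y, y ∂(ν K) = 0)
    (hv : ∀ K, 0 < K → ∫ y, y ^ 2 ∂(ν K) = v)
    (hL : ∀ δ : ℝ, 0 < δ →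
      Tendsto (fun K : ℕ => ∫ y in {y : ℝ | δ * √(K : ℝ) < |y|}, y ^ 2 ∂(ν K)) atTop (𝓝 0)) (b : ℝ) :
    Tendsto (fun K : ℕ => (Measure.infinitePi fun _ : ℕ => ν K).real
      {e | (∑ k ∈ Finset.range K, e k) / √(K * v) ≤ b}) atTop (𝓝 (stdNormalCDF b)) := by
  have hm : ∀ K : ℕ, Measurable fun e : ℕ → ℝ => (√(K : ℝ))⁻¹ * ∑ k ∈ Finset.range K, e k / √v := by
    intro K; fun_prop
  set ρ : ℕ → ProbabilityMeasure ℝ := fun K => ⟨(Measure.infinitePi fun _ : ℕ => ν K).map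
      fun e => (√(K : ℝ))⁻¹ * ∑ k ∈ Finset.range K, e k / √v,
      Measure.isProbabilityMeasure_map (hm K).aemeasurable⟩ with hρ
  have hw := tendsto_map_sum_of_lindeberg ν hvpos h2 h0 hv hL ρ (fun K => rfl)
  have : NullSingletonClass (gaussianReal 0 1) := nullSingletonClass_gaussianReal one_ne_zero
  -- Portmanteau: the frontier of the half-line is one point, and the Gaussian has no atoms.
  have h3 := ProbabilityMeasure.tendsto_measure_of_null_frontier_of_tendsto' hw (E := Set.Iic b)
    (by rw [frontier_Iic]; exact measure_singleton (μ := gaussianReal 0 1) b)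
  have h4 := (ENNReal.tendsto_toReal (measure_ne_top (gaussianReal 0 1) (Set.Iic b))).comp h3
  have e : stdNormalCDF b = (gaussianReal 0 1 (Set.Iic b)).toReal := cdf_eq_real _ b
  rw [e]
  refine h4.congr fun K => ?_
  simp only [Function.comp_apply, hρ, ProbabilityMeasure.coe_mk]
  rw [Measure.map_apply (hm K) measurableSet_Iic]
  simp only [measureReal_def]
  congr 2
  ext e
  simp only [Set.mem_preimage, Set.mem_Iic, Set.mem_ofPred_eq]
  rw [← Finset.sum_div, Real.sqrt_mul (by positivity)]
  have : (√(K : ℝ))⁻¹ * ((∑ k ∈ Finset.range K, e k) / √v) = (∑ k ∈ Finset.range K, e k) / (√(K : ℝ) * √v) := by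
    ring
  rw [this]

/-! ### Splitting a signal and its covariance matrix into episodes. -/

/-- A sum over `K` consecutive episodes, split into episodes. -/
lemma sum_fin_mul_eq_sum_range_sum {M : Type*} [AddCommMonoid M] {T : ℕ} [NeZero T] (K : ℕ)
    (f : ℕ → Fin T → M) :
    ∑ i : Fin (K * T), f (i.val / T) (Fin.ofNat T i.val) = ∑ k ∈ Finset.range K, ∑ t, f k t := by
  rw [Finset.sum_range, ← Fintype.sum_prod_type', ← finProdFinEquiv.sum_comp]
  refine Finset.sum_congr rfl fun x _ => ?_
  have h1 : (x.2.val + T * x.1.val) / T = x.1.val := by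
    rw [Nat.add_mul_div_left _ _ (NeZero.pos T), Nat.div_eq_of_lt x.2.isLt, zero_add]
  have h2 : Fin.ofNat T (x.2.val + T * x.1.val) = x.2 := by
    ext
    simp [Fin.ofNat, Nat.mod_eq_of_lt x.2.isLt]
  simp only [finProdFinEquiv_apply_val, h1, h2]

/-- The length must be a multiple of `T`: the inverse of a cropped block is in general not the crop
of the inverse. -/
lemma signalCov_inv {T : ℕ} [NeZero T] {A : Matrix (Fin T) (Fin T) ℝ} (hA : IsUnit A) (K : ℕ) :
    (signalCov A (K * T))⁻¹ = signalCov A⁻¹ (K * T) := by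
  refine Matrix.inv_eq_right_inv ?_
  ext i j
  have h := sum_fin_mul_eq_sum_range_sum K (fun k t =>
    (if i.val / T = k then A (Fin.ofNat T i.val) t else 0) *
      (if k = j.val / T then A⁻¹ t (Fin.ofNat T j.val) else 0))
  have hi : i.val / T < K := (Nat.div_lt_iff_lt_mul (NeZero.pos T)).2 i.isLt
  simp only [Matrix.mul_apply, signalCov, Matrix.of_apply]
  rw [h, Finset.sum_eq_single (i.val / T)]
  · by_cases hij : i.val / T = j.val / T
    · simp only [if_true, if_pos hij]
      rw [← Matrix.mul_apply, Matrix.mul_nonsing_inv A ((Matrix.isUnit_iff_isUnit_det A).1 hA),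
        Matrix.one_apply, Matrix.one_apply]
      refine if_congr ⟨fun hm => ?_, fun hm => by rw [hm]⟩ rfl rfl
      have hm' : i.val % T = j.val % T := congrArg Fin.val hm
      ext
      rw [← Nat.div_add_mod i.val T, ← Nat.div_add_mod j.val T, hij, hm']
    · have : i ≠ j := fun h => hij (by rw [h])
      simp [hij, this]
  · intro k _ hk
    simp [Ne.symm hk]
  · intro hk
    exact absurd (Finset.mem_range.2 hi) hk

/-- The length is a variable `n` with `n = K * T`, so that the case `n = T`, `K = 1` applies without
a cast between `Fin (1 * T)` and `Fin T`. -/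
lemma sSimp_episodes {T : ℕ} [NeZero T] (n K : ℕ) (hn : n = K * T) (e : ℕ → Fin T → ℝ) :
    sSimp n (fun i => e (i.val / T) (Fin.ofNat T i.val)) =
      ∑ k ∈ Finset.range K, (1 : Fin T → ℝ) ⬝ᵥ e k := by
  subst hn
  rw [sSimp, sum_fin_mul_eq_sum_range_sum]
  simp [dotProduct]

lemma sUnif_episodes {T : ℕ} [NeZero T] {A : Matrix (Fin T) (Fin T) ℝ} (hA : IsUnit A)
    (n K : ℕ) (hn : n = K * T) (e : ℕ → Fin T → ℝ) :
    sUnif A n (fun i => e (i.val / T) (Fin.ofNat T i.val)) =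
      ∑ k ∈ Finset.range K, ((1 : Fin T → ℝ) ᵥ* A⁻¹) ⬝ᵥ e k := by
  subst hn
  rw [sUnif, signalCov_inv hA]
  have hw : ∀ i : Fin (K * T), ((1 : Fin (K * T) → ℝ) ᵥ* signalCov A⁻¹ (K * T)) i =
      ((1 : Fin T → ℝ) ᵥ* A⁻¹) (Fin.ofNat T i.val) := by
    intro i
    have h := sum_fin_mul_eq_sum_range_sum K (fun k t =>
      if k = i.val / T then A⁻¹ t (Fin.ofNat T i.val) else 0)
    have hi : i.val / T < K := (Nat.div_lt_iff_lt_mul (NeZero.pos T)).2 i.isLt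
    simp only [Matrix.vecMul, dotProduct, signalCov, Matrix.of_apply, Pi.one_apply, one_mul]
    rw [h, Finset.sum_eq_single (i.val / T) (fun k _ hk => by simp [hk])
      (fun hk => absurd (Finset.mem_range.2 hi) hk)]
    simp
  simp only [dotProduct, hw]
  exact sum_fin_mul_eq_sum_range_sum K (fun k t => ((1 : Fin T → ℝ) ᵥ* A⁻¹) t * e k t)

lemma measurable_sUnif {T : ℕ} [NeZero T] (A : Matrix (Fin T) (Fin T) ℝ) (n : ℕ) :
    Measurable (sUnif A n) := by
  unfold sUnif dotProduct; fun_prop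

lemma measurable_sSimp (n : ℕ) : Measurable (sSimp n) := by
  unfold sSimp; fun_prop

/-! ### Moments and Lindeberg's condition for linear forms of an episode. -/

namespace IsEpisodeLaw

variable {T : ℕ} {ν : Measure (Fin T → ℝ)} {m : Fin T → ℝ} {A : Matrix (Fin T) (Fin T) ℝ}

lemma memLp_dotProduct (h : IsEpisodeLaw ν m A) (w : Fin T → ℝ) : MemLp (fun x => w ⬝ᵥ x) 2 ν :=
  memLp_finsetSum _ fun t _ => (h.memLp t).const_mul (w t)

lemma integral_dotProduct (h : IsEpisodeLaw ν m A) (w : Fin T → ℝ) :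
    ∫ x, w ⬝ᵥ x ∂ν = w ⬝ᵥ m := by
  have := h.isProbabilityMeasure
  simp only [dotProduct]
  rw [integral_finsetSum _ fun t _ => ((h.memLp t).integrable (by norm_num)).const_mul (w t)]
  simp_rw [integral_const_mul, h.mean]

lemma variance_dotProduct (h : IsEpisodeLaw ν m A) (w : Fin T → ℝ) :
    Var[fun x => w ⬝ᵥ x; ν] = w ⬝ᵥ (A *ᵥ w) := by
  have := h.isProbabilityMeasure
  simp only [dotProduct, Matrix.mulVec]
  rw [variance_fun_sum fun t => (h.memLp t).const_mul (w t)]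
  refine Finset.sum_congr rfl fun s _ => ?_
  rw [Finset.mul_sum]
  refine Finset.sum_congr rfl fun t _ => ?_
  rw [covariance_const_mul_left, covariance_const_mul_right, h.cov]
  ring

/-- The quadratic form of a covariance matrix is a variance, hence nonnegative; invertibility
excludes a kernel. -/
lemma posDef (h : IsEpisodeLaw ν m A) (hA : IsUnit A) : A.PosDef := by
  have hp : A.PosSemidef := by
    refine Matrix.PosSemidef.of_dotProduct_mulVec_nonneg ?_ fun w => ?_
    · ext s t
      simp [← h.cov, covariance_comm]
    · rw [star_trivial, ← h.variance_dotProduct]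
      exact variance_nonneg _ _
  exact hp.posDef_iff_isUnit.2 hA

lemma measurable_centred (w m : Fin T → ℝ) : Measurable fun x : Fin T → ℝ => w ⬝ᵥ (x - m) := by
  simp only [dotProduct, Pi.sub_apply]; fun_prop

lemma memLp_centred (h : IsEpisodeLaw ν m A) (w : Fin T → ℝ) :
    MemLp (fun x => w ⬝ᵥ (x - m)) 2 ν := by
  have := h.isProbabilityMeasure
  simp only [dotProduct_sub]
  exact (h.memLp_dotProduct w).sub (memLp_const _)

lemma integral_centred (h : IsEpisodeLaw ν m A) (w : Fin T → ℝ) :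
    ∫ x, w ⬝ᵥ (x - m) ∂ν = 0 := by
  have := h.isProbabilityMeasure
  simp only [dotProduct_sub]
  rw [integral_sub ((h.memLp_dotProduct w).integrable (by norm_num)) (integrable_const _),
    h.integral_dotProduct]
  simp

lemma integral_centred_sq (h : IsEpisodeLaw ν m A) (w : Fin T → ℝ) :
    ∫ x, (w ⬝ᵥ (x - m)) ^ 2 ∂ν = w ⬝ᵥ (A *ᵥ w) := by
  rw [← h.variance_dotProduct, variance_eq_integral (h.memLp_dotProduct w).aestronglyMeasurable.aemeasurable,
    h.integral_dotProduct]
  simp only [dotProduct_sub]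

end IsEpisodeLaw

/-- The truncated square of a linear form is controlled by the truncated squares of the entries. -/
lemma indicator_dotProduct_sq_le {ι : Type*} [Fintype ι] [Nonempty ι] (w z : ι → ℝ) {C : ℝ}
    (hC : 0 < C) (hw : ∑ t, |w t| ≤ C) (r : ℝ) :
    {y : ℝ | r < |y|}.indicator (fun y => y ^ 2) (w ⬝ᵥ z) ≤
      C ^ 2 * ∑ t, {y : ℝ | r / C < |y|}.indicator (fun y => y ^ 2) (z t) := by
  have hnn : ∀ t, 0 ≤ {y : ℝ | r / C < |y|}.indicator (fun y => y ^ 2) (z t) := fun t =>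
    Set.indicator_nonneg (fun y _ => sq_nonneg y) _
  by_cases hr : r < |w ⬝ᵥ z|
  -- At the entry `s` of largest modulus `|w ⬝ᵥ z| ≤ C * |z s|`, so the single entry `z s` already
  -- exceeds `r / C` and bounds the square.
  · obtain ⟨s, -, hs⟩ := Finset.exists_max_image Finset.univ (fun t => |z t|) Finset.univ_nonempty
    have hle : |w ⬝ᵥ z| ≤ C * |z s| := calc
      _ ≤ ∑ t, |w t * z t| := Finset.abs_sum_le_sum_abs _ _
      _ ≤ ∑ t, |w t| * |z s| := by
        refine Finset.sum_le_sum fun t ht => ?_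
        rw [abs_mul]; exact mul_le_mul_of_nonneg_left (hs t ht) (abs_nonneg _)
      _ ≤ _ := by rw [← Finset.sum_mul]; gcongr
    have hs' : r / C < |z s| := by rw [div_lt_iff₀' hC]; exact hr.trans_le hle
    rw [Set.indicator_of_mem (by exact hr)]
    calc (w ⬝ᵥ z) ^ 2 = |w ⬝ᵥ z| ^ 2 := (sq_abs _).symm
      _ ≤ (C * |z s|) ^ 2 := by gcongr
      _ = C ^ 2 * {y : ℝ | r / C < |y|}.indicator (fun y => y ^ 2) (z s) := by
        rw [Set.indicator_of_mem (by exact hs'), mul_pow, sq_abs]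
      _ ≤ _ := by
        gcongr
        exact Finset.single_le_sum (f := fun t => {y : ℝ | r / C < |y|}.indicator (fun y => y ^ 2) (z t))
          (fun t _ => hnn t) (Finset.mem_univ s)
  · rw [Set.indicator_of_notMem (by exact hr)]
    exact mul_nonneg (sq_nonneg _) (Finset.sum_nonneg fun t _ => hnn t)

lemma measurableSet_lt_abs (r : ℝ) : MeasurableSet {y : ℝ | r < |y|} :=
  measurableSet_lt (by fun_prop) (by fun_prop)

/-- Lindeberg's condition passes from the entries of the episodes to linear forms. -/
lemma tendsto_lindeberg_dotProduct {T : ℕ} [NeZero T] {A : Matrix (Fin T) (Fin T) ℝ}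
    (ν : ℕ → Measure (Fin T → ℝ)) (m : ℕ → Fin T → ℝ) (hν : ∀ K, 0 < K → IsEpisodeLaw (ν K) (m K) A)
    (hL : ∀ t : Fin T, ∀ δ : ℝ, 0 < δ → Tendsto (fun K : ℕ =>
      ∫ x in {x : Fin T → ℝ | δ * √(K : ℝ) < |x t - m K t|}, (x t - m K t) ^ 2 ∂(ν K)) atTop (𝓝 0))
    (w : Fin T → ℝ) (δ : ℝ) (hδ : 0 < δ) :
    Tendsto (fun K : ℕ => ∫ y in {y : ℝ | δ * √(K : ℝ) < |y|}, y ^ 2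
      ∂((ν K).map fun x => w ⬝ᵥ (x - m K))) atTop (𝓝 0) := by
  -- The `+ 1` makes `C` positive even for `w = 0`.
  set C := ∑ t, |w t| + 1 with hC
  have hC0 : 0 < C := by positivity
  have hlim : Tendsto (fun K : ℕ => C ^ 2 * ∑ t, ∫ x in {x : Fin T → ℝ | δ / C * √(K : ℝ) < |x t - m K t|},
      (x t - m K t) ^ 2 ∂(ν K)) atTop (𝓝 0) := by
    have := (tendsto_finsetSum Finset.univ fun t _ => hL t (δ / C) (by positivity)).const_mul (C ^ 2)
    simpa using this
  refine tendsto_of_tendsto_of_tendsto_of_le_of_le' tendsto_const_nhds hlim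
    (Eventually.of_forall fun K => integral_nonneg fun y => sq_nonneg y) ?_
  filter_upwards [eventually_gt_atTop 0] with K hK
  have h := hν K hK
  have hpm := h.isProbabilityMeasure
  rw [setIntegral_map (measurableSet_lt_abs _) (by fun_prop)
    (IsEpisodeLaw.measurable_centred w (m K)).aemeasurable]
  have hm1 : MeasurableSet ((fun x : Fin T → ℝ => w ⬝ᵥ (x - m K)) ⁻¹' {y : ℝ | δ * √(K : ℝ) < |y|}) :=
    (IsEpisodeLaw.measurable_centred w (m K)) (measurableSet_lt_abs _)
  have hm2 : ∀ t, MeasurableSet {x : Fin T → ℝ | δ / C * √(K : ℝ) < |x t - m K t|} := fun t =>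
    measurableSet_lt (by fun_prop) (by fun_prop)
  have hi : ∀ t, Integrable (fun x : Fin T → ℝ => (x t - m K t) ^ 2) (ν K) := fun t =>
    ((h.memLp t).sub (memLp_const (m K t))).integrable_sq
  rw [← integral_indicator hm1]
  simp_rw [← integral_indicator (hm2 _)]
  rw [← integral_finsetSum _ fun t _ => (hi t).indicator (hm2 t), ← integral_const_mul]
  refine integral_mono ((h.memLp_centred w).integrable_sq.indicator hm1)
    ((integrable_finsetSum _ fun t _ => (hi t).indicator (hm2 t)).const_mul _) fun x => ?_
  have := indicator_dotProduct_sq_le w (x - m K) hC0 (by rw [hC]; linarith) (δ * √(K : ℝ))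
  rw [show δ * √(K : ℝ) / C = δ / C * √(K : ℝ) by ring] at this
  exact this

/-- The central limit theorem for a linear statistic of the episodes. -/
lemma tendsto_cdf_sum_dotProduct {T : ℕ} [NeZero T] {A : Matrix (Fin T) (Fin T) ℝ}
    (ν : ℕ → Measure (Fin T → ℝ)) [∀ K, IsProbabilityMeasure (ν K)] (m : ℕ → Fin T → ℝ)
    (hν : ∀ K, 0 < K → IsEpisodeLaw (ν K) (m K) A)
    (hL : ∀ t : Fin T, ∀ δ : ℝ, 0 < δ → Tendsto (fun K : ℕ =>
      ∫ x in {x : Fin T → ℝ | δ * √(K : ℝ) < |x t - m K t|}, (x t - m K t) ^ 2 ∂(ν K)) atTop (𝓝 0))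
    (w : Fin T → ℝ) (hw : 0 < w ⬝ᵥ (A *ᵥ w)) (b : ℝ) :
    Tendsto (fun K : ℕ => (Measure.infinitePi fun _ : ℕ => ν K).real
      {e | (∑ k ∈ Finset.range K, w ⬝ᵥ e k - K * (w ⬝ᵥ m K)) / √(K * (w ⬝ᵥ (A *ᵥ w))) ≤ b}) atTop
      (𝓝 (stdNormalCDF b)) := by
  have hm := fun K => IsEpisodeLaw.measurable_centred w (m K)
  have : ∀ K, IsProbabilityMeasure ((ν K).map fun x => w ⬝ᵥ (x - m K)) := fun K =>
    Measure.isProbabilityMeasure_map (hm K).aemeasurable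
  refine (tendsto_cdf_sum_of_lindeberg (fun K => (ν K).map fun x => w ⬝ᵥ (x - m K)) hw
    (fun K hK => ?_) (fun K hK => ?_) (fun K hK => ?_)
    (tendsto_lindeberg_dotProduct ν m hν hL w) b).congr fun K => ?_
  · exact (memLp_map_measure_iff (by fun_prop) (hm K).aemeasurable).2 ((hν K hK).memLp_centred w)
  · rw [integral_map (hm K).aemeasurable (by fun_prop), (hν K hK).integral_centred]
  · rw [integral_map (hm K).aemeasurable (by fun_prop), (hν K hK).integral_centred_sq]
  -- A coordinatewise image of a product measure is the product of the images, so the centred linear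
  -- forms of the episodes are again i.i.d.
  · rw [← Measure.infinitePi_map_pi (fun _ : ℕ => ν K) (fun _ => hm K),
      map_measureReal_apply (by fun_prop) (measurableSet_le (by fun_prop) (by fun_prop))]
    congr 1
    ext e
    simp [dotProduct_sub, Finset.sum_sub_distrib]

/-- Lindeberg's condition holds when all rows have the same law. -/
lemma tendsto_lindeberg_const {Ω : Type*} [MeasurableSpace Ω] {P : Measure Ω} {Y : Ω → ℝ}
    (hY : MemLp Y 2 P) (δ : ℝ) (hδ : 0 < δ) :
    Tendsto (fun K : ℕ => ∫ ω in {ω | δ * √(K : ℝ) < |Y ω|}, Y ω ^ 2 ∂P) atTop (𝓝 0) := by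
  have hm : ∀ K : ℕ, NullMeasurableSet {ω | δ * √(K : ℝ) < |Y ω|} P := fun K =>
    nullMeasurableSet_lt aemeasurable_const hY.aestronglyMeasurable.aemeasurable.abs
  simp_rw [fun K => (integral_indicator₀ (f := fun ω => Y ω ^ 2) (hm K)).symm]
  rw [← integral_zero Ω ℝ (μ := P)]
  refine tendsto_integral_of_dominated_convergence (fun ω => Y ω ^ 2)
    (fun K => hY.integrable_sq.aestronglyMeasurable.indicator₀ (hm K)) hY.integrable_sq
    (fun K => ae_of_all _ fun ω => ?_) (ae_of_all _ fun ω => ?_)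
  · refine (norm_indicator_le_norm_self _ _).trans ?_
    simp
  · have ht : Tendsto (fun K : ℕ => δ * √(K : ℝ)) atTop atTop :=
      (Real.tendsto_sqrt_atTop.comp tendsto_natCast_atTop_atTop).const_mul_atTop hδ
    refine tendsto_const_nhds.congr' ?_
    filter_upwards [ht.eventually_ge_atTop |Y ω|] with K hK
    rw [Set.indicator_of_notMem (by simpa using hK)]

/-! ### Episodic signals and the limit law of additive statistics. -/

section EpisodicLaw

variable {Ω : Type*} [MeasurableSpace Ω] {X : ℕ → Ω → ℝ} {T : ℕ} [NeZero T]

/-- The first episode of an episodic signal has the episode law. -/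
lemma hasLaw_first_episode {P : Measure Ω} {ν : Measure (Fin T → ℝ)} [IsProbabilityMeasure ν] {K : ℕ}
    (hK : 0 < K) (h : HasLaw (obs X (K * T)) (episodicLaw T ν (K * T)) P) : HasLaw (obs X T) ν P := by
  have hlt : ∀ t : Fin T, t.val < K * T := fun t => t.isLt.trans_le (Nat.le_mul_of_pos_left T hK)
  refine HasLaw.fun_comp (X := obs X (K * T)) (Y := fun x t => x ⟨t.val, hlt t⟩)
    ⟨(measurable_pi_lambda _ fun t => measurable_pi_apply _).aemeasurable, ?_⟩ h
  rw [episodicLaw, Measure.map_map (measurable_pi_lambda _ fun t => measurable_pi_apply _) (by fun_prop)]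
  conv_rhs => rw [← Measure.infinitePi_map_eval (fun _ : ℕ => ν) 0]
  congr 1
  ext e t
  have h2 : Fin.ofNat T t.val = t := by ext; simp [Fin.ofNat, Nat.mod_eq_of_lt t.isLt]
  simp only [Function.comp_apply, Nat.div_eq_of_lt t.isLt, h2]

/-- Events about an episodic signal, expressed through the independent episodes. -/
lemma measureReal_obs_eq {P : Measure Ω} {ν : Measure (Fin T → ℝ)} {n : ℕ}
    (h : HasLaw (obs X n) (episodicLaw T ν n) P) {q : (Fin n → ℝ) → Prop}
    (hq : MeasurableSet {x | q x}) :
    P.real {ω | q (obs X n ω)} = (Measure.infinitePi fun _ : ℕ => ν).real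
      {e | q fun i : Fin n => e (i.val / T) (Fin.ofNat T i.val)} := by
  rw [h.measureReal_eq hq, episodicLaw, map_measureReal_apply (by fun_prop) hq]
  rfl

variable {A : Matrix (Fin T) (Fin T) ℝ}

/-- The central limit theorem for a statistic of an episodic signal which is additive over the
episodes and linear on each of them. -/
lemma tendsto_cdf_statistic (P : ℕ → Measure Ω) (m : ℕ → Fin T → ℝ)
    (hP : ∀ K, 0 < K → IsEpisodicSignal (P K) X (K * T) T (m K) A) (hL : EpisodesLindeberg P X T m)
    (S : (n : ℕ) → (Fin n → ℝ) → ℝ) (hSm : ∀ n, Measurable (S n)) (w : Fin T → ℝ)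
    (hS : ∀ (n K : ℕ), n = K * T → ∀ e : ℕ → Fin T → ℝ,
      S n (fun i => e (i.val / T) (Fin.ofNat T i.val)) = ∑ k ∈ Finset.range K, w ⬝ᵥ e k)
    (hw : 0 < w ⬝ᵥ (A *ᵥ w)) (b : ℝ) :
    Tendsto (fun K : ℕ => (P K).real {ω | (S (K * T) (obs X (K * T) ω) - K * (w ⬝ᵥ m K)) /
      √(K * (w ⬝ᵥ (A *ᵥ w))) ≤ b}) atTop (𝓝 (stdNormalCDF b)) := by
  -- Nothing is assumed at `K = 0`; a Dirac mass fills that row so that every row is a probability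
  -- measure.
  have hex : ∀ K, ∃ ν : Measure (Fin T → ℝ), IsProbabilityMeasure ν ∧ (0 < K →
      IsEpisodeLaw ν (m K) A ∧ HasLaw (obs X (K * T)) (episodicLaw T ν (K * T)) (P K)) := by
    intro K
    rcases K.eq_zero_or_pos with rfl | hK
    · exact ⟨Measure.dirac 0, inferInstance, fun h => absurd h (lt_irrefl 0)⟩
    · obtain ⟨ν, h1, h2⟩ := hP K hK
      exact ⟨ν, h1.isProbabilityMeasure, fun _ => ⟨h1, h2⟩⟩
  choose ν hνp hν using hex
  refine (tendsto_cdf_sum_dotProduct ν m (fun K hK => (hν K hK).1) (fun t δ hδ => ?_) w hw b).congr' ?_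
  · refine (hL t δ hδ).congr' ?_
    filter_upwards [eventually_gt_atTop 0] with K hK
    have hl := hasLaw_first_episode hK (hν K hK).2
    have hm : MeasurableSet {x : Fin T → ℝ | δ * √(K : ℝ) < |x t - m K t|} :=
      measurableSet_lt (by fun_prop) (by fun_prop)
    conv_rhs => rw [← hl.map_eq]
    rw [setIntegral_map hm (Measurable.aestronglyMeasurable (by fun_prop)) hl.aemeasurable]
    rfl
  · filter_upwards [eventually_gt_atTop 0] with K hK
    rw [measureReal_obs_eq (hν K hK).2 (q := fun x => (S (K * T) x - K * (w ⬝ᵥ m K)) /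
      √(K * (w ⬝ᵥ (A *ᵥ w))) ≤ b)
      (measurableSet_le (((hSm _).sub_const _).div_const _) measurable_const)]
    simp_rw [hS (K * T) K rfl]

lemma aemeasurable_statistic {P : Measure Ω} {m : Fin T → ℝ} {n : ℕ}
    (hP : IsEpisodicSignal P X n T m A) {S : (Fin n → ℝ) → ℝ} (hS : Measurable S) :
    AEMeasurable (fun ω => S (obs X n ω)) P := by
  obtain ⟨ν, -, h⟩ := hP
  exact hS.comp_aemeasurable h.aemeasurable

/-- The null hypothesis does not depend on `K`, so it satisfies Lindeberg's condition. -/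
lemma episodesLindeberg_const {P : Measure Ω} {m : Fin T → ℝ}
    (hP : IsEpisodicSignal P X (1 * T) T m A) : EpisodesLindeberg (fun _ => P) X T (fun _ => m) := by
  obtain ⟨ν, h, hl⟩ := hP
  have hνp := h.isProbabilityMeasure
  have hl := hasLaw_first_episode one_pos hl
  intro t δ hδ
  have hY : MemLp (fun ω => X t ω - m t) 2 P := by
    have hx : MemLp (fun x : Fin T → ℝ => x t - m t) 2 ν := (h.memLp t).sub (memLp_const _)
    rw [← hl.map_eq, memLp_map_measure_iff (Measurable.aestronglyMeasurable (by fun_prop))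
      hl.aemeasurable] at hx
    exact hx
  exact tendsto_lindeberg_const hY δ hδ

lemma integral_variance_statistic {P : Measure Ω} {m : Fin T → ℝ}
    (hP : IsEpisodicSignal P X (1 * T) T m A) (S : (n : ℕ) → (Fin n → ℝ) → ℝ) (w : Fin T → ℝ)
    (hS : ∀ (n K : ℕ), n = K * T → ∀ e : ℕ → Fin T → ℝ,
      S n (fun i => e (i.val / T) (Fin.ofNat T i.val)) = ∑ k ∈ Finset.range K, w ⬝ᵥ e k) :
    ∫ ω, S T (obs X T ω) ∂P = w ⬝ᵥ m ∧ Var[fun ω => S T (obs X T ω); P] = w ⬝ᵥ (A *ᵥ w) := by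
  obtain ⟨ν, h, hl⟩ := hP
  have hνp := h.isProbabilityMeasure
  have hl := hasLaw_first_episode one_pos hl
  have hST : ∀ x : Fin T → ℝ, S T x = w ⬝ᵥ x := by
    intro x
    have := hS T 1 (one_mul T).symm (fun _ => x)
    have hx : (fun i : Fin T => x (Fin.ofNat T i.val)) = x := by
      ext i; congr 1; ext; simp [Fin.ofNat, Nat.mod_eq_of_lt i.isLt]
    rw [hx] at this
    simpa using this
  have hm : Measurable fun x : Fin T → ℝ => w ⬝ᵥ x := by simp only [dotProduct]; fun_prop
  simp_rw [hST]
  rw [← h.integral_dotProduct w, ← h.variance_dotProduct w, ← hl.map_eq,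
    integral_map hl.aemeasurable hm.aestronglyMeasurable,
    variance_map hm.aemeasurable hl.aemeasurable]
  exact ⟨rfl, rfl⟩

end EpisodicLaw

/-! ### Threshold tests and their asymptotic power. -/

section ThresholdTest

variable {Ω : Type*} [MeasurableSpace Ω] (P : Measure Ω) (s : Ω → ℝ) (κ : ℝ) {ρ : ℝ}

/-- Together with `rejectProb_le` this confines the rejection probability between `P(s < κ)` and
`P(s ≤ κ)`. These agree in the limit, so the edge probability has no influence there. -/
lemma le_rejectProb (hρ : ρ ∈ Set.Icc (0 : ℝ) 1) : P.real {ω | s ω < κ} ≤ rejectProb P s κ ρ :=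
  le_add_of_nonneg_right (mul_nonneg hρ.1 measureReal_nonneg)

lemma rejectProb_le [IsProbabilityMeasure P] (hs : AEMeasurable s P) (hρ : ρ ∈ Set.Icc (0 : ℝ) 1) :
    rejectProb P s κ ρ ≤ P.real {ω | s ω ≤ κ} := by
  have hm : NullMeasurableSet {ω | s ω = κ} P := hs.nullMeasurable (measurableSet_singleton κ)
  have hd : Disjoint {ω | s ω < κ} {ω | s ω = κ} :=
    Set.disjoint_left.2 fun ω h1 h2 => (ne_of_lt h1) h2
  have hu : {ω | s ω ≤ κ} = {ω | s ω < κ} ∪ {ω | s ω = κ} := by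
    ext ω; exact le_iff_lt_or_eq (a := s ω)
  rw [hu, measureReal_union₀ hm hd.aedisjoint, rejectProb]
  gcongr
  exact mul_le_of_le_one_left measureReal_nonneg hρ.2

end ThresholdTest

/-- The asymptotic power, under local alternatives, of tests based on a statistic which is additive
over the episodes and linear with weights `w` on each of them. -/
theorem tendsto_power_linear_statistic {Ω : Type*} [MeasurableSpace Ω] (X : ℕ → Ω → ℝ)
    (T : ℕ) [NeZero T] (μ₀ : Fin T → ℝ) (A : Matrix (Fin T) (Fin T) ℝ)
    (ε α : ℝ) (hα : α ∈ Set.Ioo (0 : ℝ) 1)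
    (P₀ : Measure Ω) [IsProbabilityMeasure P₀] (hP₀ : ∀ n : ℕ, IsEpisodicSignal P₀ X n T μ₀ A)
    (PA : ℕ → Measure Ω) [∀ K, IsProbabilityMeasure (PA K)]
    (hPA : ∀ K : ℕ, 0 < K → IsEpisodicSignal (PA K) X (K * T) T (fun t => μ₀ t - ε / √(K : ℝ)) A)
    (hL : EpisodesLindeberg PA X T (fun K t => μ₀ t - ε / √(K : ℝ)))
    (S : (n : ℕ) → (Fin n → ℝ) → ℝ) (hSm : ∀ n, Measurable (S n)) (w : Fin T → ℝ)
    (hS : ∀ (n K : ℕ), n = K * T → ∀ e : ℕ → Fin T → ℝ,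
      S n (fun i => e (i.val / T) (Fin.ofNat T i.val)) = ∑ k ∈ Finset.range K, w ⬝ᵥ e k)
    (hw : 0 < w ⬝ᵥ (A *ᵥ w)) :
    Tendsto (fun K : ℕ => (PA K).real {ω | normalizedStat P₀ X T S K ω ≤ stdNormalQuantile α}) atTop
      (𝓝 (stdNormalCDF (stdNormalQuantile α + ε * (w ⬝ᵥ 1) / √(w ⬝ᵥ (A *ᵥ w))))) ∧
    ∀ κ ρ : ℕ → ℝ, (∀ K, ρ K ∈ Set.Icc (0 : ℝ) 1) →
      (∀ K, 0 < K → rejectProb P₀ (fun ω => S (K * T) (obs X (K * T) ω)) (κ K) (ρ K) = α) →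
      Tendsto (fun K : ℕ => rejectProb (PA K) (fun ω => S (K * T) (obs X (K * T) ω)) (κ K) (ρ K)) atTop
        (𝓝 (stdNormalCDF (stdNormalQuantile α + ε * (w ⬝ᵥ 1) / √(w ⬝ᵥ (A *ᵥ w))))) := by
  set v := w ⬝ᵥ (A *ᵥ w) with hv
  set q := stdNormalQuantile α
  set d := ε * (w ⬝ᵥ 1) / √v with hd
  obtain ⟨hmean, hvar⟩ := integral_variance_statistic (hP₀ (1 * T)) S w hS
  have h0 : ∀ b, Tendsto (fun K : ℕ => P₀.real
      {ω | (S (K * T) (obs X (K * T) ω) - K * (w ⬝ᵥ μ₀)) / √(K * v) ≤ b}) atTop (𝓝 (stdNormalCDF b)) :=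
    tendsto_cdf_statistic (fun _ => P₀) (fun _ => μ₀) (fun K _ => hP₀ _)
      (episodesLindeberg_const (hP₀ (1 * T))) S hSm w hS hw
  have hA := tendsto_cdf_statistic PA _ hPA hL S hSm w hS hw
  have hpos : ∀ K : ℕ, 0 < K → 0 < √(K * v) := fun K hK => by
    have : (0 : ℝ) < K := by exact_mod_cast hK
    positivity
  -- The mean moves by `K * (ε / √K) * (w ⬝ᵥ 1)`; division by `√(K * v)` cancels `K`, which is why
  -- the alternatives approach the null at rate `1 / √K`.
  have hshift : ∀ K : ℕ, 0 < K → ∀ x : ℝ,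
      (x - K * (w ⬝ᵥ fun t => μ₀ t - ε / √(K : ℝ))) / √(K * v) = (x - K * (w ⬝ᵥ μ₀)) / √(K * v) + d := by
    intro K hK x
    have hK' : (0 : ℝ) < K := by exact_mod_cast hK
    have h1 : (w ⬝ᵥ fun t => μ₀ t - ε / √(K : ℝ)) = w ⬝ᵥ μ₀ - ε / √(K : ℝ) * (w ⬝ᵥ 1) := by
      rw [show (fun t => μ₀ t - ε / √(K : ℝ)) = μ₀ - (ε / √(K : ℝ)) • (1 : Fin T → ℝ) by
        ext t; simp, dotProduct_sub, dotProduct_smul, smul_eq_mul]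
    have hs : 0 < √(K : ℝ) := Real.sqrt_pos.2 hK'
    have hsv : 0 < √v := Real.sqrt_pos.2 hw
    have hsK : (K : ℝ) = √(K : ℝ) ^ 2 := (Real.sq_sqrt hK'.le).symm
    rw [h1, hd, Real.sqrt_mul hK'.le]
    generalize √(K : ℝ) = r at *
    rw [hsK]
    field_simp
    ring
  constructor
  · refine (hA (q + d)).congr' ?_
    filter_upwards [eventually_gt_atTop 0] with K hK
    congr 1
    ext ω
    simp only [Set.mem_ofPred_eq, normalizedStat, hmean, hvar]
    rw [hshift K hK, add_le_add_iff_right]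
  · intro κ ρ hρ hsig
    -- A normalized threshold staying below some `a < q` would force a level near at most `Φ(a) <
    -- α`, and one staying above some `a > q` a level exceeding `α`.
    have hb : Tendsto (fun K : ℕ => (κ K - K * (w ⬝ᵥ μ₀)) / √(K * v)) atTop (𝓝 q) := by
      have hq : stdNormalCDF q = α := stdNormalCDF_quantile hα
      rw [tendsto_order]
      constructor
      · intro a ha
        have hlt : stdNormalCDF a < α := hq ▸ strictMono_stdNormalCDF ha
        filter_upwards [eventually_gt_atTop 0, (h0 a).eventually (gt_mem_nhds hlt)] with K hK hlt
        by_contra! hcon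
        have hr := rejectProb_le P₀ _ (κ K) (aemeasurable_statistic (hP₀ (K * T)) (hSm _)) (hρ K)
        rw [hsig K hK] at hr
        refine absurd hr (not_le.2 (lt_of_le_of_lt ?_ hlt))
        refine measureReal_mono fun ω hω => le_trans ?_ hcon
        exact div_le_div_of_nonneg_right (sub_le_sub_right hω _) (hpos K hK).le
      · intro a ha
        -- Rejection is certain only for `s < κ`, so the room between `c` and `a` turns `≤ c` into a
        -- strict inequality.
        obtain ⟨c, hc1, hc2⟩ := exists_between ha
        have hlt : α < stdNormalCDF c := hq ▸ strictMono_stdNormalCDF hc1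
        filter_upwards [eventually_gt_atTop 0, (h0 c).eventually (lt_mem_nhds hlt)] with K hK hlt
        by_contra! hcon
        have hr := le_rejectProb P₀ (fun ω => S (K * T) (obs X (K * T) ω)) (κ K) (hρ K)
        rw [hsig K hK] at hr
        refine absurd hr (not_le.2 (hlt.trans_le ?_))
        refine measureReal_mono fun ω hω => ?_
        simp only [Set.mem_ofPred_eq] at hω ⊢
        have := hω.trans_lt (hc2.trans_le hcon)
        rwa [div_lt_div_iff_of_pos_right (hpos K hK), sub_lt_sub_iff_right] at this
    have hmono : ∀ K : ℕ, Monotone fun b => (PA K).real {ω | (S (K * T) (obs X (K * T) ω) -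
        K * (w ⬝ᵥ fun t => μ₀ t - ε / √(K : ℝ))) / √(K * v) ≤ b} := fun K x y hxy =>
      measureReal_mono fun ω (hω : _ ≤ x) => hω.trans hxy
    refine tendsto_of_tendsto_pointwise_of_monotone continuous_stdNormalCDF hmono hA
      (hb.add_const d) ?_ ?_
    · filter_upwards [eventually_gt_atTop 0] with K hK
      refine (rejectProb_le (PA K) _ (κ K) (aemeasurable_statistic (hPA K hK) (hSm _)) (hρ K)).trans ?_
      refine measureReal_mono fun ω hω => ?_
      simp only [Set.mem_ofPred_eq, hshift K hK] at hω ⊢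
      gcongr
    · filter_upwards [eventually_gt_atTop 0] with K hK x hx
      refine le_trans (measureReal_mono fun ω hω => ?_) (le_rejectProb (PA K) _ (κ K) (hρ K))
      simp only [Set.mem_ofPred_eq, hshift K hK] at hω ⊢
      have := lt_of_add_lt_add_right (hω.trans_lt hx)
      rwa [div_lt_div_iff_of_pos_right (hpos K hK), sub_lt_sub_iff_right] at this

/-! ### Comparison of the two limits and conclusion. -/

/-- Cauchy-Schwarz for a positive definite form and its inverse. -/
lemma sq_dotProduct_le_of_posDef {ι : Type*} [Fintype ι] [DecidableEq ι] {A : Matrix ι ι ℝ}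
    (hA : A.PosDef) (x : ι → ℝ) : (x ⬝ᵥ x) ^ 2 ≤ (x ⬝ᵥ (A *ᵥ x)) * (x ⬝ᵥ (A⁻¹ *ᵥ x)) := by
  have hdet := (Matrix.isUnit_iff_isUnit_det A).1 hA.isUnit
  have hT : Aᵀ = A := by simpa using hA.isHermitian.eq
  have h1 : A *ᵥ (A⁻¹ *ᵥ x) = x := by rw [mulVec_mulVec, Matrix.mul_nonsing_inv A hdet, one_mulVec]
  have h2 : (A⁻¹ *ᵥ x) ⬝ᵥ (A *ᵥ x) = x ⬝ᵥ x := by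
    rw [dotProduct_mulVec, ← mulVec_transpose, hT, h1]
  -- This is the `A`-form evaluated at `A⁻¹ x - c x`, a quadratic in `c` that is never negative; its
  -- discriminant is then at most zero.
  have key : ∀ c : ℝ, 0 ≤ (x ⬝ᵥ (A *ᵥ x)) * (c * c) + (-2 * (x ⬝ᵥ x)) * c + x ⬝ᵥ (A⁻¹ *ᵥ x) := by
    intro c
    have := hA.posSemidef.dotProduct_mulVec_nonneg (A⁻¹ *ᵥ x - c • x)
    rw [star_trivial, mulVec_sub, mulVec_smul, h1, sub_dotProduct, dotProduct_sub, dotProduct_sub,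
      dotProduct_smul, smul_dotProduct, smul_dotProduct, dotProduct_smul, h2,
      dotProduct_comm (A⁻¹ *ᵥ x) x] at this
    simp only [smul_eq_mul] at this
    linarith
  have := discrim_le_zero key
  rw [discrim] at this
  linarith

theorem theorem2 {Ω : Type*} [MeasurableSpace Ω] (X : ℕ → Ω → ℝ)
    (T : ℕ) [NeZero T] (μ₀ : Fin T → ℝ) (Sig₀ : Matrix (Fin T) (Fin T) ℝ) (hSig₀ : IsUnit Sig₀)
    (ε : ℝ) (hε : 0 ≤ ε) (α : ℝ) (hα : α ∈ Set.Ioo (0 : ℝ) 1)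
    -- the null hypothesis, for every length of the signal
    (P₀ : Measure Ω) [IsProbabilityMeasure P₀]
    (hP₀ : ∀ n : ℕ, IsEpisodicSignal P₀ X n T μ₀ Sig₀)
    -- the alternative hypothesis with `K` episodes, for every `K ≥ 1`
    (PA : ℕ → Measure Ω) [∀ K, IsProbabilityMeasure (PA K)]
    (hPA : ∀ K : ℕ, 0 < K →
      IsEpisodicSignal (PA K) X (K * T) T (fun t => μ₀ t - ε / √(K : ℝ)) Sig₀)
    (hLind : EpisodesLindeberg PA X T (fun K t => μ₀ t - ε / √(K : ℝ))) :
    -- asymptotic power of the tests with threshold `q_α` on the normalized statistics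
    Tendsto (fun K : ℕ =>
        (PA K).real {ω | normalizedStat P₀ X T sSimp K ω ≤ stdNormalQuantile α}) atTop
      (𝓝 (stdNormalCDF (stdNormalQuantile α + ε * T / √((1 : Fin T → ℝ) ⬝ᵥ (Sig₀ *ᵥ 1))))) ∧
    stdNormalCDF (stdNormalQuantile α + ε * T / √((1 : Fin T → ℝ) ⬝ᵥ (Sig₀ *ᵥ 1))) ≤
      stdNormalCDF (stdNormalQuantile α + ε * √((1 : Fin T → ℝ) ⬝ᵥ (Sig₀⁻¹ *ᵥ 1))) ∧
    Tendsto (fun K : ℕ =>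
        (PA K).real {ω | normalizedStat P₀ X T (sUnif Sig₀) K ω ≤ stdNormalQuantile α}) atTop
      (𝓝 (stdNormalCDF (stdNormalQuantile α + ε * √((1 : Fin T → ℝ) ⬝ᵥ (Sig₀⁻¹ *ᵥ 1))))) ∧
    -- the same limits for all threshold tests tuned to have significance exactly `α`
    (∀ κ ρ : ℕ → ℝ, (∀ K, ρ K ∈ Set.Icc (0 : ℝ) 1) →
      (∀ K, 0 < K → rejectProb P₀ (fun ω => sSimp (K * T) (obs X (K * T) ω)) (κ K) (ρ K) = α) →
      Tendsto (fun K : ℕ =>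
          rejectProb (PA K) (fun ω => sSimp (K * T) (obs X (K * T) ω)) (κ K) (ρ K)) atTop
        (𝓝 (stdNormalCDF (stdNormalQuantile α + ε * T / √((1 : Fin T → ℝ) ⬝ᵥ (Sig₀ *ᵥ 1)))))) ∧
    (∀ κ ρ : ℕ → ℝ, (∀ K, ρ K ∈ Set.Icc (0 : ℝ) 1) →
      (∀ K, 0 < K →
        rejectProb P₀ (fun ω => sUnif Sig₀ (K * T) (obs X (K * T) ω)) (κ K) (ρ K) = α) →
      Tendsto (fun K : ℕ =>
          rejectProb (PA K) (fun ω => sUnif Sig₀ (K * T) (obs X (K * T) ω)) (κ K) (ρ K)) atTop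
        (𝓝 (stdNormalCDF (stdNormalQuantile α + ε * √((1 : Fin T → ℝ) ⬝ᵥ (Sig₀⁻¹ *ᵥ 1)))))) := by
  have : Nonempty (Fin T) := ⟨0⟩
  have hpd : Sig₀.PosDef := by
    -- Any length would do: even the empty signal comes with an episode law of covariance `Sig₀`.
    obtain ⟨ν, h, -⟩ := hP₀ 0
    exact h.posDef hSig₀
  have hdet := (Matrix.isUnit_iff_isUnit_det Sig₀).1 hSig₀
  have hone : (1 : Fin T → ℝ) ≠ 0 := one_ne_zero
  have hv : 0 < (1 : Fin T → ℝ) ⬝ᵥ (Sig₀ *ᵥ 1) := by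
    simpa using hpd.dotProduct_mulVec_pos hone
  have hu : 0 < (1 : Fin T → ℝ) ⬝ᵥ (Sig₀⁻¹ *ᵥ 1) := by
    simpa using hpd.inv.dotProduct_mulVec_pos hone
  have hcard : (1 : Fin T → ℝ) ⬝ᵥ 1 = T := by simp
  have hsymm : (1 : Fin T → ℝ) ᵥ* Sig₀⁻¹ = Sig₀⁻¹ *ᵥ 1 := by
    have hT : (Sig₀⁻¹)ᵀ = Sig₀⁻¹ := by simpa using hpd.inv.isHermitian.eq
    rw [← mulVec_transpose, hT]
  -- For the weights of `sUnif` the variance and `w ⬝ᵥ 1` are the same number `u`, so the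
  -- displacement is `ε * u / √u = ε * √u`.
  have hwv : ((1 : Fin T → ℝ) ᵥ* Sig₀⁻¹) ⬝ᵥ (Sig₀ *ᵥ ((1 : Fin T → ℝ) ᵥ* Sig₀⁻¹)) =
      (1 : Fin T → ℝ) ⬝ᵥ (Sig₀⁻¹ *ᵥ 1) := by
    rw [hsymm, mulVec_mulVec, Matrix.mul_nonsing_inv Sig₀ hdet, one_mulVec, dotProduct_comm]
  have hw1 : ((1 : Fin T → ℝ) ᵥ* Sig₀⁻¹) ⬝ᵥ 1 = (1 : Fin T → ℝ) ⬝ᵥ (Sig₀⁻¹ *ᵥ 1) :=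
    (dotProduct_mulVec _ _ _).symm
  have hsimp := tendsto_power_linear_statistic X T μ₀ Sig₀ ε α hα P₀ hP₀ PA hPA hLind sSimp
    measurable_sSimp 1 sSimp_episodes hv
  have hunif := tendsto_power_linear_statistic X T μ₀ Sig₀ ε α hα P₀ hP₀ PA hPA hLind (sUnif Sig₀)
    (measurable_sUnif Sig₀) ((1 : Fin T → ℝ) ᵥ* Sig₀⁻¹) (sUnif_episodes hSig₀) (hwv ▸ hu)
  rw [hcard] at hsimp
  rw [hw1, hwv, mul_div_assoc, Real.div_sqrt] at hunif
  refine ⟨hsimp.1, strictMono_stdNormalCDF.monotone ?_, hunif.1, hsimp.2, hunif.2⟩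
  rw [mul_div_assoc]
  gcongr
  rw [div_le_iff₀ (Real.sqrt_pos.2 hv), ← Real.sqrt_mul hu.le]
  refine Real.le_sqrt_of_sq_le ?_
  rw [← hcard, mul_comm]
  exact sq_dotProduct_le_of_posDef hpd 1
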